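/- Let $\mathcal E$ be a directed graph with vertex set $\mathcal E^0$, nonempty edge set $\mathcal E^1$, range and source maps $r,s$, and a labelling $\mathcal L:\mathcal E^1\to\mathcal A$. Let $\mathcal L^*$ be the set of labels of finite paths together with the empty word $\omega$. For $A\subseteq\mathcal E^0$ and a word $\alpha$, let $r(A,\alpha)$ be the set of ranges of paths labelled $\alpha$ with source in $A$ (with $r(A,\omega)=A$), and $r(\alpha)=r(\mathcal E^0,\alpha)$. Let $\mathcal B$ be a family of subsets of $\mathcal E^0$ which is closed under $A\mapsto r(A,\alpha)$ ($\alpha\in\mathcal L^*$), under finite intersections and unions and under relative complements, contains $r(\alpha)$ for all $\alpha\in\mathcal L^*\setminus\{\omega\}$, and is weakly left resolving: $r(A\cap B,\alpha)=r(A,\alpha)\cap r(B,\alpha)$ for all $A,B\in\mathcal B$ and $\alpha\in\mathcal L^*\setminus\{\omega\}$. Put $\mathcal B_\alpha=\{A\in\mathcal B: A\subseteq r(\alpha)\}$, ordered by inclusion. Let $S$ be the inverse semigroup consisting of $0$ and of the triples $(\alpha,A,\beta)$ with $\alpha,\beta\in\mathcal L^*$ and $\emptyset\ne A\in\mathcal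 B_\alpha\cap\mathcal B_\beta$, with product $(\alpha,A,\beta)(\gamma,B,\delta)=(\alpha\gamma',r(A,\gamma')\cap B,\delta)$ if $\gamma=\beta\gamma'$, $(\alpha,A\cap r(B,\beta'),\delta\beta')$ if $\beta=\gamma\beta'$, and $0$ otherwise (triples with empty middle entry being read as $0$). Its idempotents form the semilattice $E(S)=\{(\alpha,A,\alpha)\}\cup\{0\}$, with meet $pq$ and order $p\le q\iff pq=p$. A filter in a poset with least element $0$ is a nonempty, upward closed, downward directed subset not containing $0$; an ultrafilter is a maximal filter. A cover for $x\in E(S)$ is a set $Z\subseteq\{z: z\le x\}$ such that every $y$ with $0\neq y\le x$ satisfies $z\wedge y\ne0$ for some $z\in Z$. A filter $\xi$ in $E(S)$ is tight if its characteristic function $\phi_\xi:E(S)\to\{0,1\}$ is a tight character, i.e. $\bigvee_{z\in Z}\phi_\xi(z)=\phi_\xi(x)$ for every $x\in E(S)$ and every finite cover $Z$ for $x$. A net $(G_\lambda)$ of subsets of a poset $P$ converges to $G\subseteq P$ if for each $x\in P$ there is $\lambda_0$ such that, for all $\lambda\ge\lambda_0$, $x\in G_\lambda\iff x\in G$. Let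 $X_\alpha$ be the set of ultrafilters in $\mathcal B_\alpha$, let $X_\alpha^{sink}=\{\mathcal F\in X_\alpha: \forall b\in\mathcal A\ \exists A\in\mathcal F,\ r(A,b)=\emptyset\}$, and for $t\in\mathcal A$ with $\alpha t\in\mathcal L^*$ and $\mathcal F\in X_{\alpha t}$ let $f_{\alpha[t]}(\mathcal F)=\{A\in\mathcal B_\alpha: r(A,t)\in\mathcal F\}$ (which may be empty if $\alpha=\omega$). **Proposition.** Let $\xi^\alpha$ be a filter of finite type in $E(S)$ with word $\alpha\in\mathcal L^*$, i.e. $(\alpha,A,\alpha)\in\xi^\alpha$ for some $A$, and $\alpha$ has the largest length among all words $\beta$ such that $(\beta,B,\beta)\in\xi^\alpha$ for some $B$. Let $\xi_{|\alpha|}=\{A\in\mathcal B_\alpha:(\alpha,A,\alpha)\in\xi^\alpha\}$. Then $\xi^\alpha$ is tight if and only if $\xi_{|\alpha|}$ is an ultrafilter in $\mathcal B_\alpha$ and at least one of the following holds: (a) there is a net $(\mathcal F_\lambda)_{\lambda\in\Lambda}$ in $X_\alpha^{sink}$ converging to $\xi_{|\alpha|}$; (b) there is a net $(t_\lambda,\mathcal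 F_\lambda)_{\lambda\in\Lambda}$ with $t_\lambda\in\mathcal A$, $\alpha t_\lambda\in\mathcal L^*$ and $\mathcal F_\lambda\in X_{\alpha t_\lambda}$ for each $\lambda$, such that $(f_{\alpha[t_\lambda]}(\mathcal F_\lambda))_{\lambda\in\Lambda}$ converges to $\xi_{|\alpha|}$ and for every $b\in\mathcal A$ there is $\lambda_b\in\Lambda$ with $t_\lambda\neq b$ for all $\lambda\ge\lambda_b$. -/

import Mathlib

universe u v w

/-! ### Filters, covers, characters and tightness in ordered sets with a least element -/

/-- A filter in a partially ordered set with least element: a nonempty, upward closed, downward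
directed subset that does not contain the least element. -/
structure IsProperFilter {P : Type*} [PartialOrder P] [OrderBot P] (ξ : Set P) : Prop where
  nonempty : ξ.Nonempty
  bot_notMem : ⊥ ∉ ξ
  mem_of_le : ∀ ⦃x y : P⦄, x ∈ ξ → x ≤ y → y ∈ ξ
  directed : ∀ ⦃x y : P⦄, x ∈ ξ → y ∈ ξ → ∃ z ∈ ξ, z ≤ x ∧ z ≤ y

/-- An ultrafilter is a filter that is not properly contained in any filter. -/
def IsUltrafilterIn {P : Type*} [PartialOrder P] [OrderBot P] (ξ : Set P) : Prop :=
  Maximal IsProperFilter ξ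

/-- `Z` is a cover for `x`: every element of `Z` lies below `x`, and every nonzero `y ≤ x`
meets some element of `Z`. -/
def IsCoverFor {P : Type*} [SemilatticeInf P] [OrderBot P] (Z : Set P) (x : P) : Prop :=
  (∀ z ∈ Z, z ≤ x) ∧ ∀ y, y ≤ x → y ≠ ⊥ → ∃ z ∈ Z, z ⊓ y ≠ ⊥

/-- Characters of a semilattice with zero; the two-element Boolean algebra is `Prop`. -/
structure IsSemilatticeCharacter {P : Type*} [SemilatticeInf P] [OrderBot P] (φ : P → Prop) :
    Prop where
  nonzero : φ ≠ ⊥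
  map_bot : φ ⊥ = ⊥
  map_inf : ∀ x y, φ (x ⊓ y) = φ x ⊓ φ y

/-- A character `φ` is tight if `⋁_{z ∈ Z} φ z = φ x` for every `x` and every finite cover `Z`
for `x`. -/
def IsTightCharacter {P : Type*} [SemilatticeInf P] [OrderBot P] (φ : P → Prop) : Prop :=
  IsSemilatticeCharacter φ ∧
    ∀ (x : P) (Z : Set P), Z.Finite → IsCoverFor Z x → (⨆ z ∈ Z, φ z) = φ x

/-- The characteristic function of a subset, as a map to the two-element Boolean algebra. -/
def charOf {P : Type*} (ξ : Set P) : P → Prop := fun x => x ∈ ξ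

/-- A filter is tight if its characteristic function is a tight character. -/
def IsTightFilter {P : Type*} [SemilatticeInf P] [OrderBot P] (ξ : Set P) : Prop :=
  IsProperFilter ξ ∧ IsTightCharacter (charOf ξ)

/-- Pointwise convergence of a net `F` of subsets of `P` to a subset `G`. -/
def NetConvergesTo {P : Type*} {Λ : Type*} [Preorder Λ] (F : Λ → Set P) (G : Set P) : Prop :=
  ∀ x : P, ∃ l₀ : Λ, ∀ l, l₀ ≤ l → (x ∈ F l ↔ x ∈ G)

/-! ### Labelled graphs -/

/-- A directed graph with vertex set `V` and edge set `E`, labelled over the alphabet `𝓐`. -/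
structure LabelledGraph (V : Type u) (E : Type v) (𝓐 : Type w) where
  src : E → V
  tgt : E → V
  lab : E → 𝓐

namespace LabelledGraph

variable {V : Type u} {E : Type v} {𝓐 : Type w} (G : LabelledGraph V E 𝓐)

/-- `G.IsPath x p y`: the edge list `p` is a path with source `x` and range `y`. The paths of
length `0` are the vertices. -/
def IsPath : V → List E → V → Prop
  | x, [], y => x = y
  | x, e :: p, y => G.src e = x ∧ IsPath (G.tgt e) p y

/-- The finite words that are labels of paths, together with the empty word. -/
def IsLabelledPath (α : List 𝓐) : Prop :=
  α = [] ∨ ∃ x p y, G.IsPath x p y ∧ p.map G.lab = α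

/-- The relative range `r(A, α)`: the ranges of the paths labelled `α` with source in `A`. -/
def relRange (A : Set V) (α : List 𝓐) : Set V :=
  {y | ∃ x ∈ A, ∃ p, G.IsPath x p y ∧ p.map G.lab = α}

/-- The range `r(α)` of a word. -/
def range (α : List 𝓐) : Set V := G.relRange Set.univ α

theorem isPath_append {x y : V} {p q : List E} :
    G.IsPath x (p ++ q) y ↔ ∃ z, G.IsPath x p z ∧ G.IsPath z q y := by
  induction p generalizing x with
  | nil => simp [IsPath]
  | cons e p ih => simp [IsPath, ih, and_assoc]

@[simp] theorem relRange_nil (A : Set V) : G.relRange A [] = A := by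
  ext y
  simp [relRange, IsPath]

theorem relRange_append (A : Set V) (α β : List 𝓐) :
    G.relRange A (α ++ β) = G.relRange (G.relRange A α) β := by
  ext y
  constructor
  · rintro ⟨x, hx, p, hp, hl⟩
    obtain ⟨p₁, p₂, rfl, h₁, h₂⟩ := List.map_eq_append_iff.1 hl
    obtain ⟨z, hz₁, hz₂⟩ := G.isPath_append.1 hp
    exact ⟨z, ⟨x, hx, p₁, hz₁, h₁⟩, p₂, hz₂, h₂⟩
  · rintro ⟨z, ⟨x, hx, p₁, hz₁, h₁⟩, p₂, hz₂, h₂⟩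
    exact ⟨x, hx, p₁ ++ p₂, G.isPath_append.2 ⟨z, hz₁, hz₂⟩, by simp [h₁, h₂]⟩

theorem relRange_mono {A B : Set V} (h : A ⊆ B) (α : List 𝓐) :
    G.relRange A α ⊆ G.relRange B α := by
  rintro y ⟨x, hx, p, hp⟩
  exact ⟨x, h hx, p, hp⟩

theorem IsLabelledPath.suffix {α β : List 𝓐} (h : G.IsLabelledPath (α ++ β)) :
    G.IsLabelledPath β := by
  rcases h with h | ⟨x, p, y, hp, hl⟩
  · exact Or.inl (List.append_eq_nil_iff.1 h).2
  · obtain ⟨p₁, p₂, rfl, h₁, h₂⟩ := List.map_eq_append_iff.1 hl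
    obtain ⟨z, hz₁, hz₂⟩ := G.isPath_append.1 hp
    exact Or.inr ⟨z, p₂, y, hz₂, h₂⟩

end LabelledGraph

/-! ### Labelled spaces -/

/-- A labelled space: a labelled graph with an accommodating family `fam` of vertex sets. -/
structure LabelledSpace (V : Type u) (E : Type v) (𝓐 : Type w) extends
    LabelledGraph V E 𝓐 where
  fam : Set (Set V)
  relRange_mem : ∀ A ∈ fam, ∀ α, toLabelledGraph.IsLabelledPath α →
    toLabelledGraph.relRange A α ∈ fam
  inter_mem : ∀ A ∈ fam, ∀ B ∈ fam, A ∩ B ∈ fam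
  union_mem : ∀ A ∈ fam, ∀ B ∈ fam, A ∪ B ∈ fam
  range_mem : ∀ α, α ≠ [] → toLabelledGraph.IsLabelledPath α → toLabelledGraph.range α ∈ fam

namespace LabelledSpace

variable {V : Type u} {E : Type v} {𝓐 : Type w} (L : LabelledSpace V E 𝓐)

/-- The labelled space is weakly left resolving. -/
class WeaklyLeftResolving : Prop where
  relRange_inter : ∀ A ∈ L.fam, ∀ B ∈ L.fam, ∀ α, α ≠ [] → L.IsLabelledPath α →
    L.relRange (A ∩ B) α = L.relRange A α ∩ L.relRange B α

/-- The accommodating family is closed under relative complements. -/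
class ClosedUnderRelCompl : Prop where
  sdiff_mem : ∀ A ∈ L.fam, ∀ B ∈ L.fam, A \ B ∈ L.fam

/-- The family `𝓑_α` of the members of the accommodating family contained in `r(α)`, ordered by
inclusion. -/
def FamAt (α : List 𝓐) : Type u := {A : Set V // A ∈ L.fam ∧ A ⊆ L.range α}

instance (α : List 𝓐) : PartialOrder (L.FamAt α) :=
  inferInstanceAs (PartialOrder {A : Set V // A ∈ L.fam ∧ A ⊆ L.range α})

theorem empty_mem [Nonempty E] [L.ClosedUnderRelCompl] : (∅ : Set V) ∈ L.fam := by
  obtain ⟨e⟩ := ‹Nonempty E›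
  have h : L.range [L.lab e] ∈ L.fam :=
    L.range_mem _ (by simp) (Or.inr ⟨L.src e, [e], L.tgt e, by simp [LabelledGraph.IsPath]⟩)
  simpa using ClosedUnderRelCompl.sdiff_mem _ h _ h

instance [Nonempty E] [L.ClosedUnderRelCompl] (α : List 𝓐) : OrderBot (L.FamAt α) where
  bot := ⟨∅, L.empty_mem, Set.empty_subset _⟩
  bot_le A := Set.empty_subset A.1

/-! ### The inverse semigroup -/

/-- The nonzero elements `(α, A, β)` of the inverse semigroup of the labelled space. -/
@[ext]
structure Triple where
  left : List 𝓐
  carrier : Set V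
  right : List 𝓐
  left_path : L.IsLabelledPath left
  right_path : L.IsLabelledPath right
  carrier_mem : carrier ∈ L.fam
  sub_left : carrier ⊆ L.range left
  sub_right : carrier ⊆ L.range right
  carrier_nonempty : carrier.Nonempty

/-- The inverse semigroup `S` of the labelled space: the triples `(α, A, β)`, all those with
`A = ∅` being identified with an adjoined zero. -/
def InvSemigroup : Type (max u w) := WithZero L.Triple

instance : Zero L.InvSemigroup := inferInstanceAs (Zero (WithZero L.Triple))

/-- A triple as an element of `S`. -/
def ofTriple (t : L.Triple) : L.InvSemigroup := (t : WithZero L.Triple)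

open Classical in
/-- The class of `(α, A, β)` in `S`: it is zero if `A = ∅`. The side conditions only serve to make
this a total function; in the product below they hold whenever `A ≠ ∅`, see `valid_left` and
`valid_right`. -/
noncomputable def cls (α : List 𝓐) (A : Set V) (β : List 𝓐) : L.InvSemigroup :=
  if h : (L.IsLabelledPath α ∧ L.IsLabelledPath β ∧ A ∈ L.fam ∧ A ⊆ L.range α ∧
      A ⊆ L.range β) ∧ A.Nonempty then
    L.ofTriple ⟨α, A, β, h.1.1, h.1.2.1, h.1.2.2.1, h.1.2.2.2.1, h.1.2.2.2.2, h.2⟩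
  else 0

open Classical in
/-- The product of `(α, A, β)` and `(γ, B, δ)`: it is `(αγ', r(A, γ') ∩ B, δ)` if `γ = βγ'`,
`(α, A ∩ r(B, β'), δβ')` if `β = γβ'`, and zero otherwise. -/
noncomputable def tripleMul (s t : L.Triple) : L.InvSemigroup :=
  if s.right <+: t.left then
    L.cls (s.left ++ t.left.drop s.right.length)
      (L.relRange s.carrier (t.left.drop s.right.length) ∩ t.carrier) t.right
  else if t.left <+: s.right then
    L.cls s.left (s.carrier ∩ L.relRange t.carrier (s.right.drop t.left.length))
      (t.right ++ s.right.drop t.left.length)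
  else 0

/-- The product of `S`, in which zero is absorbing. -/
noncomputable def mulAux : WithZero L.Triple → WithZero L.Triple → L.InvSemigroup
  | some s, some t => L.tripleMul s t
  | _, _ => 0

noncomputable instance : Mul L.InvSemigroup := ⟨L.mulAux⟩

theorem ofTriple_mul (s t : L.Triple) :
    L.ofTriple s * L.ofTriple t = L.tripleMul s t := rfl

protected theorem zero_mul' (s : L.InvSemigroup) : 0 * s = 0 := rfl

protected theorem mul_zero' (s : L.InvSemigroup) : s * 0 = 0 := by
  cases s <;> rfl

theorem ofTriple_ne_zero (t : L.Triple) : L.ofTriple t ≠ 0 := WithZero.coe_ne_zero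

theorem ofTriple_injective : Function.Injective L.ofTriple := WithZero.coe_injective

theorem eq_zero_or (s : L.InvSemigroup) : s = 0 ∨ ∃ t, s = L.ofTriple t := by
  cases s with
  | none => exact Or.inl rfl
  | some t => exact Or.inr ⟨t, rfl⟩

/-- The semilattice `E(S)` of idempotents of `S`. -/
def Idem : Type (max u w) := {p : L.InvSemigroup // IsIdempotentElem p}

variable {L}

theorem valid_left (s t : L.Triple) {γ : List 𝓐} (h : t.left = s.right ++ γ)
    (hne : (L.relRange s.carrier γ ∩ t.carrier).Nonempty) :
    L.IsLabelledPath (s.left ++ γ) ∧ L.IsLabelledPath t.right ∧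
      L.relRange s.carrier γ ∩ t.carrier ∈ L.fam ∧
      L.relRange s.carrier γ ∩ t.carrier ⊆ L.range (s.left ++ γ) ∧
      L.relRange s.carrier γ ∩ t.carrier ⊆ L.range t.right := by
  have hsub : L.relRange s.carrier γ ∩ t.carrier ⊆ L.range (s.left ++ γ) := by
    rw [LabelledGraph.range, LabelledGraph.relRange_append]
    exact Set.inter_subset_left.trans (L.relRange_mono s.sub_left γ)
  refine ⟨?_, t.right_path, ?_, hsub, Set.inter_subset_right.trans t.sub_right⟩
  · obtain ⟨y, hy⟩ := hne
    obtain ⟨x, -, p, hp⟩ := hsub hy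
    exact Or.inr ⟨x, p, y, hp⟩
  · refine L.inter_mem _ (L.relRange_mem _ s.carrier_mem _ ?_) _ t.carrier_mem
    exact LabelledGraph.IsLabelledPath.suffix _ (h ▸ t.left_path)

theorem valid_right (s t : L.Triple) {γ : List 𝓐} (h : s.right = t.left ++ γ)
    (hne : (s.carrier ∩ L.relRange t.carrier γ).Nonempty) :
    L.IsLabelledPath s.left ∧ L.IsLabelledPath (t.right ++ γ) ∧
      s.carrier ∩ L.relRange t.carrier γ ∈ L.fam ∧
      s.carrier ∩ L.relRange t.carrier γ ⊆ L.range s.left ∧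
      s.carrier ∩ L.relRange t.carrier γ ⊆ L.range (t.right ++ γ) := by
  have hsub : s.carrier ∩ L.relRange t.carrier γ ⊆ L.range (t.right ++ γ) := by
    rw [LabelledGraph.range, LabelledGraph.relRange_append]
    exact Set.inter_subset_right.trans (L.relRange_mono t.sub_right γ)
  refine ⟨s.left_path, ?_, ?_, Set.inter_subset_left.trans s.sub_left, hsub⟩
  · obtain ⟨y, hy⟩ := hne
    obtain ⟨x, -, p, hp⟩ := hsub hy
    exact Or.inr ⟨x, p, y, hp⟩
  · refine L.inter_mem _ s.carrier_mem _ (L.relRange_mem _ t.carrier_mem _ ?_)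
    exact LabelledGraph.IsLabelledPath.suffix _ (h ▸ s.right_path)

theorem cls_eq_ofTriple {α β : List 𝓐} {A : Set V} {t : L.Triple} :
    L.cls α A β = L.ofTriple t ↔ α = t.left ∧ A = t.carrier ∧ β = t.right := by
  unfold cls
  constructor
  · intro h
    split_ifs at h with hv
    · have := L.ofTriple_injective h
      subst this
      exact ⟨rfl, rfl, rfl⟩
    · exact absurd h.symm (L.ofTriple_ne_zero t)
  · rintro ⟨rfl, rfl, rfl⟩
    rw [dif_pos ⟨⟨t.left_path, t.right_path, t.carrier_mem, t.sub_left, t.sub_right⟩,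
      t.carrier_nonempty⟩]

theorem cls_eq_zero_or (α : List 𝓐) (A : Set V) (β : List 𝓐) :
    L.cls α A β = 0 ∨
      ∃ t, L.cls α A β = L.ofTriple t ∧ α = t.left ∧ A = t.carrier ∧ β = t.right := by
  rcases L.eq_zero_or (L.cls α A β) with h | ⟨t, h⟩
  · exact Or.inl h
  · exact Or.inr ⟨t, h, cls_eq_ofTriple.1 h⟩

theorem diag_mul {s t : L.Triple} (hs : s.left = s.right) (ht : t.left = t.right) {γ : List 𝓐}
    (h : t.left = s.left ++ γ) :
    L.ofTriple s * L.ofTriple t = L.cls t.left (L.relRange s.carrier γ ∩ t.carrier) t.left ∧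
      L.ofTriple t * L.ofTriple s =
        L.cls t.left (L.relRange s.carrier γ ∩ t.carrier) t.left := by
  have h₁ : s.right <+: t.left := ⟨γ, by rw [h, hs]⟩
  have h₂ : s.left <+: t.right := ⟨γ, by rw [← ht, h]⟩
  have e₁ : t.left.drop s.right.length = γ := by rw [h, hs]; simp
  have e₂ : t.right.drop s.left.length = γ := by rw [← ht, h]; simp
  refine ⟨?_, ?_⟩
  · rw [ofTriple_mul, tripleMul, if_pos h₁, e₁, ← h, ← ht]
  · rw [ofTriple_mul, tripleMul]
    split_ifs with h₃
    · have hγ : γ = [] := by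
        have := h₃.length_le
        rw [← ht, h] at this
        simpa using this
      subst hγ
      rw [List.append_nil] at h
      have e₃ : s.left.drop t.right.length = [] := by rw [← ht, h]; simp
      rw [e₃, ← hs, ← h]
      simp [Set.inter_comm]
    · rw [e₂, ← hs, ← h, Set.inter_comm]

theorem diag_mul_eq_zero {s t : L.Triple} (hs : s.left = s.right)
    (h₁ : ¬ s.left <+: t.left) (h₂ : ¬ t.left <+: s.left) :
    L.ofTriple s * L.ofTriple t = 0 := by
  rw [ofTriple_mul, tripleMul, if_neg (hs ▸ h₁), if_neg (hs ▸ h₂)]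

theorem isIdempotentElem_ofTriple {t : L.Triple} :
    IsIdempotentElem (L.ofTriple t) ↔ t.left = t.right := by
  constructor
  · intro h
    unfold IsIdempotentElem at h
    rw [ofTriple_mul, tripleMul] at h
    split_ifs at h with h₁ h₂
    · obtain ⟨γ, hγ⟩ := h₁
      have := (cls_eq_ofTriple.1 h).1
      rw [← hγ] at this
      simp at this
      simp [← hγ, this]
    · obtain ⟨γ, hγ⟩ := h₂
      have := (cls_eq_ofTriple.1 h).2.2
      rw [← hγ] at this
      simp at this
      simp [← hγ, this]
    · exact absurd h.symm (L.ofTriple_ne_zero t)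
  · intro h
    have := (diag_mul h h (γ := []) (by simp)).1
    rw [IsIdempotentElem, this]
    exact cls_eq_ofTriple.2 ⟨rfl, by simp, h⟩

theorem isIdempotentElem_zero : IsIdempotentElem (0 : L.InvSemigroup) := L.zero_mul' 0

theorem isIdempotentElem_cls (α : List 𝓐) (A : Set V) : IsIdempotentElem (L.cls α A α) := by
  rcases cls_eq_zero_or (L := L) α A α with h | ⟨t, h, h₁, -, h₂⟩
  · rw [h]; exact isIdempotentElem_zero
  · rw [h]; exact isIdempotentElem_ofTriple.2 (h₁.symm.trans h₂)

theorem idem_mul {p q : L.InvSemigroup} (hp : IsIdempotentElem p) (hq : IsIdempotentElem q) :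
    IsIdempotentElem (p * q) ∧ p * q = q * p := by
  rcases L.eq_zero_or p with rfl | ⟨s, rfl⟩
  · rw [L.zero_mul', L.mul_zero']; exact ⟨isIdempotentElem_zero, rfl⟩
  rcases L.eq_zero_or q with rfl | ⟨t, rfl⟩
  · rw [L.zero_mul', L.mul_zero']; exact ⟨isIdempotentElem_zero, rfl⟩
  rw [isIdempotentElem_ofTriple] at hp hq
  by_cases h₁ : s.left <+: t.left
  · obtain ⟨γ, hγ⟩ := h₁
    obtain ⟨e₁, e₂⟩ := diag_mul hp hq hγ.symm
    rw [e₁, e₂]; exact ⟨isIdempotentElem_cls _ _, rfl⟩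
  by_cases h₂ : t.left <+: s.left
  · obtain ⟨γ, hγ⟩ := h₂
    obtain ⟨e₁, e₂⟩ := diag_mul hq hp hγ.symm
    rw [e₁, e₂]; exact ⟨isIdempotentElem_cls _ _, rfl⟩
  rw [diag_mul_eq_zero hp h₁ h₂, diag_mul_eq_zero hq h₂ h₁]
  exact ⟨isIdempotentElem_zero, rfl⟩

theorem diag_mul_eq_left {s t : L.Triple} (hs : s.left = s.right) (ht : t.left = t.right) :
    L.ofTriple s * L.ofTriple t = L.ofTriple s ↔
      ∃ γ, s.left = t.left ++ γ ∧ s.carrier ⊆ L.relRange t.carrier γ := by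
  constructor
  · intro h
    by_cases h₂ : t.left <+: s.left
    · obtain ⟨γ, hγ⟩ := h₂
      rw [(diag_mul ht hs hγ.symm).2, cls_eq_ofTriple] at h
      exact ⟨γ, hγ.symm, Set.inter_eq_right.1 h.2.1⟩
    by_cases h₁ : s.left <+: t.left
    · obtain ⟨γ, hγ⟩ := h₁
      rw [(diag_mul hs ht hγ.symm).1, cls_eq_ofTriple] at h
      exact absurd (h.1 ▸ List.prefix_rfl) h₂
    · rw [diag_mul_eq_zero hs h₁ h₂] at h
      exact absurd h.symm (L.ofTriple_ne_zero s)
  · rintro ⟨γ, hγ, hsub⟩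
    rw [(diag_mul ht hs hγ).2, cls_eq_ofTriple]
    exact ⟨rfl, Set.inter_eq_right.2 hsub, hs⟩

theorem idem_mul_trans {p q r : L.InvSemigroup} (hp : IsIdempotentElem p)
    (hq : IsIdempotentElem q) (hr : IsIdempotentElem r) (h₁ : p * q = p) (h₂ : q * r = q) :
    p * r = p := by
  rcases L.eq_zero_or p with rfl | ⟨s, rfl⟩
  · exact L.zero_mul' r
  rcases L.eq_zero_or q with rfl | ⟨t, rfl⟩
  · rw [L.mul_zero'] at h₁; rw [← h₁, L.zero_mul']
  rcases L.eq_zero_or r with rfl | ⟨x, rfl⟩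
  · rw [L.mul_zero'] at h₂; exact absurd h₂.symm (L.ofTriple_ne_zero t)
  rw [isIdempotentElem_ofTriple] at hp hq hr
  rw [diag_mul_eq_left hp hq] at h₁
  rw [diag_mul_eq_left hq hr] at h₂
  rw [diag_mul_eq_left hp hr]
  obtain ⟨γ, hγ, hs⟩ := h₁
  obtain ⟨δ, hδ, ht⟩ := h₂
  refine ⟨δ ++ γ, by rw [hγ, hδ, List.append_assoc], ?_⟩
  rw [LabelledGraph.relRange_append]
  exact hs.trans (L.relRange_mono ht γ)

theorem idem_mul_le {p q : L.InvSemigroup} (hp : IsIdempotentElem p)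
    (hq : IsIdempotentElem q) : p * q * q = p * q := by
  rcases L.eq_zero_or p with rfl | ⟨s, rfl⟩
  · simp only [L.zero_mul']
  rcases L.eq_zero_or q with rfl | ⟨t, rfl⟩
  · simp only [L.mul_zero']
  rw [isIdempotentElem_ofTriple] at hp hq
  by_cases h₁ : s.left <+: t.left
  · obtain ⟨γ, hγ⟩ := h₁
    rw [(diag_mul hp hq hγ.symm).1]
    rcases cls_eq_zero_or (L := L) t.left (L.relRange s.carrier γ ∩ t.carrier) t.left with
      h | ⟨x, h, hx₁, hx₂, hx₃⟩
    · rw [h]; rfl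
    · rw [h, diag_mul_eq_left (hx₁.symm.trans hx₃) hq]
      exact ⟨[], by simp [hx₁], by rw [← hx₂]; simp⟩
  by_cases h₂ : t.left <+: s.left
  · obtain ⟨γ, hγ⟩ := h₂
    rw [(diag_mul hq hp hγ.symm).2]
    rcases cls_eq_zero_or (L := L) s.left (L.relRange t.carrier γ ∩ s.carrier) s.left with
      h | ⟨x, h, hx₁, hx₂, hx₃⟩
    · rw [h]; rfl
    · rw [h, diag_mul_eq_left (hx₁.symm.trans hx₃) hq]
      exact ⟨γ, by rw [← hx₁, hγ], by rw [← hx₂]; exact Set.inter_subset_left⟩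
  rw [diag_mul_eq_zero hp h₁ h₂]; rfl

theorem diag_le_mul [L.WeaklyLeftResolving] {x s t : L.Triple} (hx : x.left = x.right)
    (hs : s.left = s.right) (ht : t.left = t.right) {γ : List 𝓐} (hγ : t.left = s.left ++ γ)
    (h₁ : L.ofTriple x * L.ofTriple s = L.ofTriple x)
    (h₂ : L.ofTriple x * L.ofTriple t = L.ofTriple x) :
    L.ofTriple x * (L.ofTriple s * L.ofTriple t) = L.ofTriple x := by
  rw [diag_mul_eq_left hx hs] at h₁
  rw [diag_mul_eq_left hx ht] at h₂
  obtain ⟨δ, hδ, hs'⟩ := h₁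
  obtain ⟨ε, hε, ht'⟩ := h₂
  have hδε : δ = γ ++ ε := by
    have := hδ.symm.trans hε
    rw [hγ, List.append_assoc] at this
    exact List.append_cancel_left this
  have hsub : x.carrier ⊆ L.relRange (L.relRange s.carrier γ ∩ t.carrier) ε := by
    rcases eq_or_ne ε [] with rfl | hne
    · rw [LabelledGraph.relRange_nil] at ht' ⊢
      rw [hδε, List.append_nil] at hs'
      exact Set.subset_inter hs' ht'
    · rw [WeaklyLeftResolving.relRange_inter _ (L.relRange_mem _ s.carrier_mem _
        (LabelledGraph.IsLabelledPath.suffix _ (hγ ▸ t.left_path))) _ t.carrier_mem ε hne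
        (LabelledGraph.IsLabelledPath.suffix _ (hε ▸ x.left_path)),
        ← LabelledGraph.relRange_append, ← hδε]
      exact Set.subset_inter hs' ht'
  have hne : (L.relRange s.carrier γ ∩ t.carrier).Nonempty := by
    obtain ⟨y, hy⟩ := x.carrier_nonempty
    obtain ⟨z, hz, -⟩ := hsub hy
    exact ⟨z, hz⟩
  obtain ⟨v₁, -, v₂, v₃, -⟩ := valid_left s t (by rw [← hs, hγ]) hne
  rw [← hγ] at v₁ v₃
  have hcls : L.cls t.left (L.relRange s.carrier γ ∩ t.carrier) t.left = L.ofTriple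
      ⟨t.left, L.relRange s.carrier γ ∩ t.carrier, t.left, v₁, v₁, v₂, v₃, v₃, hne⟩ :=
    cls_eq_ofTriple.2 ⟨rfl, rfl, rfl⟩
  rw [(diag_mul hs ht hγ).1, hcls, diag_mul_eq_left hx rfl]
  exact ⟨ε, hε, hsub⟩

theorem idem_le_mul [L.WeaklyLeftResolving] {p q r : L.InvSemigroup} (hp : IsIdempotentElem p)
    (hq : IsIdempotentElem q) (hr : IsIdempotentElem r) (h₁ : p * q = p) (h₂ : p * r = p) :
    p * (q * r) = p := by
  rcases L.eq_zero_or p with rfl | ⟨x, rfl⟩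
  · exact L.zero_mul' _
  rcases L.eq_zero_or q with rfl | ⟨s, rfl⟩
  · rw [L.mul_zero'] at h₁; exact absurd h₁.symm (L.ofTriple_ne_zero x)
  rcases L.eq_zero_or r with rfl | ⟨t, rfl⟩
  · rw [L.mul_zero'] at h₂; exact absurd h₂.symm (L.ofTriple_ne_zero x)
  have hc := (idem_mul hq hr).2
  rw [isIdempotentElem_ofTriple] at hp hq hr
  have h₁' := (diag_mul_eq_left hp hq).1 h₁
  have h₂' := (diag_mul_eq_left hp hr).1 h₂
  obtain ⟨δ, hδ, -⟩ := h₁'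
  obtain ⟨ε, hε, -⟩ := h₂'
  rcases List.prefix_or_prefix_of_prefix (⟨δ, hδ.symm⟩ : s.left <+: x.left)
    (⟨ε, hε.symm⟩ : t.left <+: x.left) with ⟨γ, hγ⟩ | ⟨γ, hγ⟩
  · exact diag_le_mul hp hq hr hγ.symm h₁ h₂
  · rw [hc]; exact diag_le_mul hp hr hq hγ.symm h₂ h₁

variable (L)

/-- The natural order `p ≤ q ↔ pq = p`, with the product as meet and `0` as least element. -/
noncomputable instance [L.WeaklyLeftResolving] : SemilatticeInf L.Idem where
  le p q := p.1 * q.1 = p.1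
  le_refl p := p.2
  le_trans p q r h₁ h₂ := idem_mul_trans p.2 q.2 r.2 h₁ h₂
  le_antisymm p q h₁ h₂ := Subtype.ext (h₁.symm.trans ((idem_mul p.2 q.2).2.trans h₂))
  inf p q := ⟨p.1 * q.1, (idem_mul p.2 q.2).1⟩
  inf_le_left p q := by
    change p.1 * q.1 * p.1 = p.1 * q.1
    rw [(idem_mul p.2 q.2).2]; exact idem_mul_le q.2 p.2
  inf_le_right p q := idem_mul_le p.2 q.2
  le_inf p q r h₁ h₂ := idem_le_mul p.2 q.2 r.2 h₁ h₂

instance [L.WeaklyLeftResolving] : OrderBot L.Idem where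
  bot := ⟨0, isIdempotentElem_zero⟩
  bot_le p := L.zero_mul' p.1

/-- The idempotent `(α, A, α)` for `A ∈ 𝓑_α` (zero if `A = ∅`). -/
noncomputable def idem (α : List 𝓐) (A : L.FamAt α) : L.Idem :=
  ⟨L.cls α A.1 α, isIdempotentElem_cls α A.1⟩

/-- `ξ_α = {A ∈ 𝓑_α | (α, A, α) ∈ ξ}`. -/
def fiber (ξ : Set L.Idem) (α : List 𝓐) : Set (L.FamAt α) := {A | L.idem α A ∈ ξ}

/-- `ξ` is a filter of finite type in `E(S)` with associated (finite) word `α`: the word `α` occurs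
in `ξ` and has the largest length among all words that occur in `ξ`. -/
def IsFiniteTypeFilter [L.WeaklyLeftResolving] (ξ : Set L.Idem) (α : List 𝓐) : Prop :=
  IsProperFilter ξ ∧ L.IsLabelledPath α ∧ (∃ A, L.idem α A ∈ ξ) ∧
    ∀ β, L.IsLabelledPath β → (∃ B, L.idem β B ∈ ξ) → β.length ≤ α.length

/-! ### The spaces `X_α` -/

/-- The set `X_α` of ultrafilters in `𝓑_α`. -/
def ultraAt [Nonempty E] [L.ClosedUnderRelCompl] (α : List 𝓐) : Set (Set (L.FamAt α)) :=
  {F | IsUltrafilterIn F}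

/-- The set `X_α^sink`. -/
def ultraSink [Nonempty E] [L.ClosedUnderRelCompl] (α : List 𝓐) : Set (Set (L.FamAt α)) :=
  {F | F ∈ L.ultraAt α ∧ ∀ b : 𝓐, ∃ A ∈ F, L.relRange A.1 [b] = ∅}

/-- The map `f_{α[β]}`, sending `F ⊆ 𝓑_{αβ}` to `{A ∈ 𝓑_α | r(A, β) ∈ F}`. -/
def pullback (α β : List 𝓐) (F : Set (L.FamAt (α ++ β))) : Set (L.FamAt α) :=
  {A | ∃ C ∈ F, C.1 = L.relRange A.1 β}

end LabelledSpace

/-! A proper filter is tight iff it meets every finite cover of each of its members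
(`IsProperFilter.isTightFilter_iff`). Say that D emits b if r(D, b) ≠ ∅, and that B is a sink set if
it emits no letter.

Let ξ be tight. The pieces A ∩ C and A \ C cover (α, A, α), which makes the fibre at α an
ultrafilter (`fiber_mem_ultraAt`). If a member D of the fibre emitted only finitely many letters and
contained no nonempty sink set of 𝓑_α, the elements (αb, r(D, b), αb) would form a finite cover, and
a word longer than α would occur in ξ (`exists_sink_of_finite`). So either every member of the fibre
contains a nonempty sink set, or all members below some D₀ emit infinitely many letters.
Ultrafilters chosen along pairs (member, finite set of letters) then give a net as in (a) or (b);
`netConvergesTo_of_eventually_mem` yields convergence.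

Conversely, let Z be a finite cover of x ∈ ξ that misses ξ. Since the fibre is an ultrafilter, some
member D avoids every element of Z whose word is a prefix of α, and only finitely many letters
continue α in the other words of Z. A nonzero element below (α, D, α) that avoids those letters
contradicts covering (`isTightFilter_of_exists_below`). From (a) comes such an element with word α,
from (b) one with word αt. -/

namespace LabelledGraph

variable {V : Type u} {E : Type v} {𝓐 : Type w} (G : LabelledGraph V E 𝓐)

@[simp] theorem relRange_empty (α : List 𝓐) : G.relRange ∅ α = ∅ := by
  simp [relRange]

theorem relRange_union (A B : Set V) (α : List 𝓐) :
    G.relRange (A ∪ B) α = G.relRange A α ∪ G.relRange B α := by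
  ext y
  simp only [relRange, Set.mem_union, Set.mem_ofPred_eq, or_and_right, exists_or]

theorem range_append (α β : List 𝓐) : G.range (α ++ β) = G.relRange (G.range α) β :=
  G.relRange_append _ α β

theorem relRange_cons (A : Set V) (a : 𝓐) (α : List 𝓐) :
    G.relRange A (a :: α) = G.relRange (G.relRange A [a]) α :=
  G.relRange_append A [a] α

theorem isLabelledPath_of_range_nonempty {α : List 𝓐} (h : (G.range α).Nonempty) :
    G.IsLabelledPath α := by
  obtain ⟨y, x, -, p, hp⟩ := h
  exact Or.inr ⟨x, p, y, hp⟩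

end LabelledGraph

/-! ### Filters, tightness and ultrafilters in ordered sets -/

/-- A proper filter contains the infimum of any two of its elements. -/
theorem IsProperFilter.inf_mem {P : Type*} [SemilatticeInf P] [OrderBot P] {ξ : Set P}
    (h : IsProperFilter ξ) {x y : P} (hx : x ∈ ξ) (hy : y ∈ ξ) : x ⊓ y ∈ ξ := by
  obtain ⟨z, hz, hzx, hzy⟩ := h.directed hx hy
  exact h.mem_of_le hz (le_inf hzx hzy)

/-- The characteristic function of a proper filter is a character. -/
theorem IsProperFilter.isSemilatticeCharacter {P : Type*} [SemilatticeInf P] [OrderBot P]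
    {ξ : Set P} (h : IsProperFilter ξ) : IsSemilatticeCharacter (charOf ξ) where
  nonzero h₀ := by
    obtain ⟨x, hx⟩ := h.nonempty
    exact (congrFun h₀ x).mp hx
  map_bot := propext ⟨fun h₀ => h.bot_notMem h₀, False.elim⟩
  map_inf x y := propext
    ⟨fun hxy => ⟨h.mem_of_le hxy inf_le_left, h.mem_of_le hxy inf_le_right⟩,
      fun hxy => h.inf_mem hxy.1 hxy.2⟩

/-- A proper filter is tight iff it meets every finite cover of each of its elements. -/
theorem IsProperFilter.isTightFilter_iff {P : Type*} [SemilatticeInf P] [OrderBot P]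
    {ξ : Set P} (h : IsProperFilter ξ) :
    IsTightFilter ξ ↔ ∀ x ∈ ξ, ∀ Z : Set P, Z.Finite → IsCoverFor Z x → ∃ z ∈ Z, z ∈ ξ := by
  have key (Z : Set P) : (⨆ z ∈ Z, charOf ξ z) ↔ ∃ z ∈ Z, z ∈ ξ := by
    simp [iSup_Prop_eq, charOf]
  constructor
  · rintro ⟨-, -, ht⟩ x hx Z hZ hc
    rw [← key, ht x Z hZ hc]
    exact hx
  · intro ht
    refine ⟨h, h.isSemilatticeCharacter, fun x Z hZ hc => propext ?_⟩
    rw [key]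
    exact ⟨fun ⟨z, hz, hzξ⟩ => h.mem_of_le hzξ (hc.1 z hz), fun hx => ht x hx Z hZ hc⟩

/-- Every nonzero element lies in an ultrafilter. -/
theorem exists_isUltrafilterIn_mem {P : Type*} [PartialOrder P] [OrderBot P] {a : P}
    (ha : a ≠ ⊥) : ∃ F : Set P, IsUltrafilterIn F ∧ a ∈ F := by
  have h₀ : IsProperFilter (Set.Ici a) :=
    ⟨⟨a, le_rfl⟩, fun h => ha (le_bot_iff.1 h), fun _ _ hx hxy => le_trans hx hxy,
      fun _ _ hx hy => ⟨a, le_rfl, hx, hy⟩⟩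
  have hchains : ∀ c ⊆ {F : Set P | IsProperFilter F}, IsChain (· ⊆ ·) c → c.Nonempty →
      IsProperFilter (⋃₀ c) := by
    intro c hc hchain hne
    obtain ⟨s, hs⟩ := hne
    refine ⟨(hc hs).nonempty.mono (Set.subset_sUnion_of_mem hs), ?_, ?_, ?_⟩
    · rintro ⟨s, hs, hb⟩
      exact (hc hs).bot_notMem hb
    · rintro x y ⟨s, hs, hx⟩ hxy
      exact ⟨s, hs, (hc hs).mem_of_le hx hxy⟩
    · rintro x y ⟨s, hs, hx⟩ ⟨s', hs', hy⟩
      obtain ⟨u, hu, hsu, hsu'⟩ := hchain.directedOn s hs s' hs'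
      obtain ⟨z, hz, h⟩ := (hc hu).directed (hsu hx) (hsu' hy)
      exact ⟨z, ⟨u, hu, hz⟩, h⟩
  obtain ⟨F, hle, hF⟩ := zorn_subset_nonempty {F : Set P | IsProperFilter F}
    (fun c hc hchain hne => ⟨⋃₀ c, hchains c hc hchain hne,
      fun s hs => Set.subset_sUnion_of_mem hs⟩) _ h₀
  exact ⟨F, hF, hle (Set.mem_Ici.2 le_rfl)⟩

namespace LabelledSpace

variable {V : Type u} {E : Type v} {𝓐 : Type w} {L : LabelledSpace V E 𝓐}

theorem relRange_inter [L.WeaklyLeftResolving] {A B : Set V} (hA : A ∈ L.fam) (hB : B ∈ L.fam)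
    {α : List 𝓐} (hα : L.IsLabelledPath α) :
    L.relRange (A ∩ B) α = L.relRange A α ∩ L.relRange B α := by
  rcases eq_or_ne α [] with rfl | hne
  · simp
  · exact WeaklyLeftResolving.relRange_inter A hA B hB α hne hα

/-! ### Operations on the families `𝓑_α` -/

namespace FamAt

variable {α β : List 𝓐}

/-- The intersection of a member of `𝓑_α` with a member of the accommodating family. -/
def inter (A : L.FamAt α) {B : Set V} (hB : B ∈ L.fam) : L.FamAt α :=
  ⟨A.1 ∩ B, L.inter_mem _ A.2.1 _ hB, Set.inter_subset_left.trans A.2.2⟩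

/-- The relative complement in a member of `𝓑_α` of a member of the accommodating family. -/
def sdiff [L.ClosedUnderRelCompl] (A : L.FamAt α) {B : Set V} (hB : B ∈ L.fam) : L.FamAt α :=
  ⟨A.1 \ B, ClosedUnderRelCompl.sdiff_mem _ A.2.1 _ hB, Set.sdiff_subset.trans A.2.2⟩

/-- The relative range `r(A, γ)` of `A ∈ 𝓑_α`, as a member of `𝓑_{αγ}`. -/
def relRange (A : L.FamAt α) {γ : List 𝓐} (h : L.IsLabelledPath (α ++ γ)) :
    L.FamAt (α ++ γ) :=
  ⟨L.toLabelledGraph.relRange A.1 γ,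
    L.relRange_mem _ A.2.1 _ (LabelledGraph.IsLabelledPath.suffix _ h), by
      rw [LabelledGraph.range_append]
      exact L.relRange_mono A.2.2 γ⟩

theorem le_iff {A B : L.FamAt α} : A ≤ B ↔ A.1 ⊆ B.1 := Iff.rfl

theorem ne_bot_iff [Nonempty E] [L.ClosedUnderRelCompl] {A : L.FamAt α} :
    A ≠ ⊥ ↔ A.1.Nonempty := by
  rw [Set.nonempty_iff_ne_empty]
  exact not_congr ⟨fun h => h ▸ rfl, fun h => Subtype.ext h⟩

end FamAt

/-! ### Filters and ultrafilters in `𝓑_α` -/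

section Filters

variable [Nonempty E] [L.ClosedUnderRelCompl] {α : List 𝓐}

theorem nonempty_of_mem {F : Set (L.FamAt α)} (hF : IsProperFilter F) {A : L.FamAt α}
    (hA : A ∈ F) : A.1.Nonempty :=
  FamAt.ne_bot_iff.1 fun h => hF.bot_notMem (h ▸ hA)

theorem inter_nonempty_of_mem {F : Set (L.FamAt α)} (hF : IsProperFilter F) {A B : L.FamAt α}
    (hA : A ∈ F) (hB : B ∈ F) : (A.1 ∩ B.1).Nonempty := by
  obtain ⟨C, hC, hCA, hCB⟩ := hF.directed hA hB
  exact (nonempty_of_mem hF hC).mono (Set.subset_inter hCA hCB)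

/-- A filter in `𝓑_α` contains a common lower bound of any finite family of its members. -/
theorem exists_mem_le_of_finite {F : Set (L.FamAt α)} (hF : IsProperFilter F) {ι : Type*}
    {s : Set ι} (hs : s.Finite) {p : ι → L.FamAt α → Prop}
    (hp : ∀ i ∈ s, ∃ C ∈ F, p i C) (hmono : ∀ i, ∀ C D, D ≤ C → p i C → p i D) {A : L.FamAt α}
    (hA : A ∈ F) : ∃ D ∈ F, D ≤ A ∧ ∀ i ∈ s, p i D := by
  induction s, hs using Set.Finite.induction_on with
  | empty => exact ⟨A, hA, le_rfl, by simp⟩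
  | @insert i s _ _ ih =>
    obtain ⟨D, hD, hDA, hDs⟩ := ih fun j hj => hp j (Set.mem_insert_of_mem _ hj)
    obtain ⟨C, hC, hCi⟩ := hp i (Set.mem_insert _ _)
    obtain ⟨B, hB, hBD, hBC⟩ := hF.directed hD hC
    refine ⟨B, hB, hBD.trans hDA, ?_⟩
    rintro j (rfl | hj)
    · exact hmono _ C B hBC hCi
    · exact hmono _ D B hBD (hDs j hj)

/-- A member of `𝓑_α` outside an ultrafilter is disjoint from some member of it. -/
theorem exists_disjoint_of_notMem {F : Set (L.FamAt α)} (hF : F ∈ L.ultraAt α)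
    {A : L.FamAt α} (hA : A ∉ F) : ∃ C ∈ F, A.1 ∩ C.1 = ∅ := by
  by_contra! hne
  obtain ⟨hp, hmax⟩ := hF
  -- The filter generated by `F` and `A`; it is proper because `A` is assumed to meet every member
  -- of `F`, so maximality puts `A` in `F`.
  have hG : IsProperFilter {D : L.FamAt α | ∃ C ∈ F, A.1 ∩ C.1 ⊆ D.1} := by
    refine ⟨?_, ?_, ?_, ?_⟩
    · obtain ⟨C, hC⟩ := hp.nonempty
      exact ⟨C, C, hC, Set.inter_subset_right⟩
    · rintro ⟨C, hC, h⟩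
      exact (hne C hC).ne_empty (Set.subset_empty_iff.1 h)
    · rintro D D' ⟨C, hC, h⟩ hD
      exact ⟨C, hC, h.trans hD⟩
    · rintro D D' ⟨C, hC, h⟩ ⟨C', hC', h'⟩
      obtain ⟨B, hB, hBC, hBC'⟩ := hp.directed hC hC'
      exact ⟨A.inter B.2.1, ⟨B, hB, subset_rfl⟩,
        (Set.inter_subset_inter_right _ hBC).trans h,
        (Set.inter_subset_inter_right _ hBC').trans h'⟩
  obtain ⟨C, hC⟩ := hp.nonempty
  exact hA (hmax hG (fun D hD => ⟨D, hD, Set.inter_subset_right⟩)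
    ⟨C, hC, Set.inter_subset_left⟩)

/-- If each `D ∈ U` eventually belongs to the filters `F l`, these converge to the
ultrafilter `U`. -/
theorem netConvergesTo_of_eventually_mem {U : Set (L.FamAt α)} (hU : U ∈ L.ultraAt α)
    {Λ : Type*} [Preorder Λ] {F : Λ → Set (L.FamAt α)}
    (hdisj : ∀ l, ∀ A ∈ F l, ∀ B ∈ F l, (A.1 ∩ B.1).Nonempty)
    (h : ∀ D ∈ U, ∃ l₀, ∀ l, l₀ ≤ l → D ∈ F l) : NetConvergesTo F U := by
  intro A
  by_cases hA : A ∈ U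
  · obtain ⟨l₀, hl₀⟩ := h A hA
    exact ⟨l₀, fun l hl => iff_of_true (hl₀ l hl) hA⟩
  -- Eventually `C` belongs to `F l`, whose members meet pairwise, so `A` does not. The sets `F l`
  -- need not be filters, which lets pullbacks be used here.
  · obtain ⟨C, hC, hAC⟩ := exists_disjoint_of_notMem hU hA
    obtain ⟨l₀, hl₀⟩ := h C hC
    exact ⟨l₀, fun l hl => iff_of_false
      (fun hAl => (hdisj l A hAl C (hl₀ l hl)).ne_empty hAC) hA⟩

end Filters

/-! ### The order of `E(S)` -/

section Order

variable {α β : List 𝓐}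

theorem isLabelledPath_of_nonempty {A : L.FamAt α} (hA : A.1.Nonempty) : L.IsLabelledPath α :=
  L.isLabelledPath_of_range_nonempty (hA.mono A.2.2)

theorem idem_eq_ofTriple (hα : L.IsLabelledPath α) (A : L.FamAt α) (hA : A.1.Nonempty) :
    (L.idem α A).1 = L.ofTriple ⟨α, A.1, α, hα, hα, A.2.1, A.2.2, A.2.2, hA⟩ :=
  cls_eq_ofTriple.2 ⟨rfl, rfl, rfl⟩

variable [L.WeaklyLeftResolving]

theorem idem_ne_bot_iff {A : L.FamAt α} : L.idem α A ≠ ⊥ ↔ A.1.Nonempty := by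
  constructor
  · intro h
    by_contra hA
    refine h (Subtype.ext ?_)
    change L.cls α A.1 α = 0
    rw [cls, dif_neg fun h => hA h.2]
  · intro hA h
    have hα := L.isLabelledPath_of_range_nonempty (hA.mono A.2.2)
    have := congrArg Subtype.val h
    rw [idem_eq_ofTriple hα A hA] at this
    exact L.ofTriple_ne_zero _ this

theorem eq_bot_or_eq_idem (p : L.Idem) :
    p = ⊥ ∨ ∃ (α : List 𝓐) (A : L.FamAt α), A.1.Nonempty ∧ p = L.idem α A := by
  obtain ⟨p, hp⟩ := p
  rcases L.eq_zero_or p with rfl | ⟨t, rfl⟩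
  · exact Or.inl rfl
  · have ht := isIdempotentElem_ofTriple.1 hp
    refine Or.inr ⟨t.left, ⟨t.carrier, t.carrier_mem, t.sub_left⟩, t.carrier_nonempty,
      Subtype.ext ?_⟩
    exact (cls_eq_ofTriple.2 ⟨rfl, rfl, ht⟩).symm

/-- Only the lower middle entry has to be nonempty: if the upper one is empty, both sides are false.
-/
theorem idem_le_idem_iff {A : L.FamAt α} {B : L.FamAt β} (hA : A.1.Nonempty) :
    L.idem α A ≤ L.idem β B ↔ ∃ γ, α = β ++ γ ∧ A.1 ⊆ L.relRange B.1 γ := by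
  rcases B.1.eq_empty_or_nonempty with hB | hB
  · have h₀ : L.idem β B = ⊥ := by
      by_contra h
      exact (idem_ne_bot_iff.1 h).ne_empty hB
    rw [h₀, le_bot_iff]
    refine iff_of_false (idem_ne_bot_iff.2 hA) ?_
    rintro ⟨γ, -, h⟩
    rw [hB, LabelledGraph.relRange_empty] at h
    exact hA.ne_empty (Set.subset_empty_iff.1 h)
  · change (L.idem α A).1 * (L.idem β B).1 = (L.idem α A).1 ↔ _
    rw [idem_eq_ofTriple (isLabelledPath_of_nonempty hA) A hA,
      idem_eq_ofTriple (isLabelledPath_of_nonempty hB) B hB]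
    exact diag_mul_eq_left rfl rfl

/-- `(αγ, B, αγ)` lies below `(α, A, α)` iff `B ⊆ r(A, γ)`. -/
theorem idem_append_le_iff {γ : List 𝓐} {B : L.FamAt (α ++ γ)} {A : L.FamAt α}
    (hB : B.1.Nonempty) : L.idem (α ++ γ) B ≤ L.idem α A ↔ B.1 ⊆ L.relRange A.1 γ := by
  rw [idem_le_idem_iff hB]
  exact ⟨fun ⟨δ, h, h'⟩ => List.append_cancel_left h ▸ h', fun h => ⟨γ, rfl, h⟩⟩

theorem idem_le_idem_self_iff {A B : L.FamAt α} (hA : A.1.Nonempty) :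
    L.idem α A ≤ L.idem α B ↔ A.1 ⊆ B.1 := by
  rw [idem_le_idem_iff hA]
  constructor
  · rintro ⟨γ, h, h'⟩
    obtain rfl : γ = [] := by simpa using h
    simpa using h'
  · exact fun h => ⟨[], by simp, by simpa using h⟩

/-- Two idempotents have a nonzero meet only if one word extends the other and the middle entries
meet after transport to the longer word. -/
theorem exists_of_idem_inf_ne_bot {A : L.FamAt α} {B : L.FamAt β}
    (h : L.idem α A ⊓ L.idem β B ≠ ⊥) :
    (∃ γ, β = α ++ γ ∧ (L.relRange A.1 γ ∩ B.1).Nonempty) ∨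
      ∃ γ, α = β ++ γ ∧ (A.1 ∩ L.relRange B.1 γ).Nonempty := by
  -- The word of the nonzero meet extends both `α` and `β`, so one of these is a prefix of the
  -- other.
  obtain h₀ | ⟨ζ, C, hC, hz⟩ := eq_bot_or_eq_idem (L.idem α A ⊓ L.idem β B)
  · exact absurd h₀ h
  obtain ⟨δ, hδ, hA⟩ := (idem_le_idem_iff hC).1 (hz.symm.trans_le inf_le_left)
  obtain ⟨ε, hε, hB⟩ := (idem_le_idem_iff hC).1 (hz.symm.trans_le inf_le_right)
  have hζ := isLabelledPath_of_nonempty hC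
  rcases List.prefix_or_prefix_of_prefix (⟨δ, hδ.symm⟩ : α <+: ζ) (⟨ε, hε.symm⟩ : β <+: ζ) with
    ⟨γ, rfl⟩ | ⟨γ, rfl⟩
  · refine Or.inl ⟨γ, rfl, ?_⟩
    obtain rfl : δ = γ ++ ε := by
      rw [hδ, List.append_assoc] at hε
      exact List.append_cancel_left hε
    rw [LabelledGraph.relRange_append] at hA
    have hβ : L.IsLabelledPath (γ ++ ε) := LabelledGraph.IsLabelledPath.suffix _ (hδ ▸ hζ)
    have hγ : L.IsLabelledPath γ :=
      LabelledGraph.IsLabelledPath.suffix _ (isLabelledPath_of_nonempty (A := B) (by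
        obtain ⟨y, hy⟩ := hC
        obtain ⟨x, hx, -⟩ := hB hy
        exact ⟨x, hx⟩))
    -- By weak left resolving, `C` lies in the range of r(A, γ) ∩ B under `ε`, so this intersection
    -- is nonempty.
    have := Set.subset_inter hA hB
    rw [← relRange_inter (L.relRange_mem _ A.2.1 _ hγ) B.2.1
      (LabelledGraph.IsLabelledPath.suffix _ hβ)] at this
    obtain ⟨y, hy⟩ := hC
    obtain ⟨x, hx, -⟩ := this hy
    exact ⟨x, hx⟩
  · refine Or.inr ⟨γ, rfl, ?_⟩
    obtain rfl : ε = γ ++ δ := by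
      rw [hε, List.append_assoc] at hδ
      exact List.append_cancel_left hδ
    rw [LabelledGraph.relRange_append] at hB
    have hβ : L.IsLabelledPath (γ ++ δ) := LabelledGraph.IsLabelledPath.suffix _ (hε ▸ hζ)
    have hγ : L.IsLabelledPath γ :=
      LabelledGraph.IsLabelledPath.suffix _ (isLabelledPath_of_nonempty (A := A) (by
        obtain ⟨y, hy⟩ := hC
        obtain ⟨x, hx, -⟩ := hA hy
        exact ⟨x, hx⟩))
    have := Set.subset_inter hA hB
    rw [← relRange_inter A.2.1 (L.relRange_mem _ B.2.1 _ hγ)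
      (LabelledGraph.IsLabelledPath.suffix _ hβ)] at this
    obtain ⟨y, hy⟩ := hC
    obtain ⟨x, hx, -⟩ := this hy
    exact ⟨x, hx⟩

theorem inf_ne_bot_of_le {p q r : L.Idem} (hr : r ≠ ⊥) (hp : r ≤ p) (hq : r ≤ q) :
    p ⊓ q ≠ ⊥ := fun h => hr (le_bot_iff.1 (h ▸ le_inf hp hq))

end Order

/-! ### Filters of finite type -/

namespace IsFiniteTypeFilter

variable [L.WeaklyLeftResolving] {ξ : Set L.Idem} {α : List 𝓐}

theorem isProperFilter (hξ : L.IsFiniteTypeFilter ξ α) : IsProperFilter ξ := hξ.1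

theorem nonempty_of_idem_mem (hξ : L.IsFiniteTypeFilter ξ α) {β : List 𝓐} {A : L.FamAt β}
    (hA : L.idem β A ∈ ξ) : A.1.Nonempty :=
  idem_ne_bot_iff.1 fun h => hξ.isProperFilter.bot_notMem (h ▸ hA)

/-- Any two elements of a filter of finite type lie above an element with the word of the
filter. -/
theorem exists_fiber_le (hξ : L.IsFiniteTypeFilter ξ α) {p : L.Idem} (hp : p ∈ ξ)
    {A : L.FamAt α} (hA : A ∈ L.fiber ξ α) :
    ∃ C ∈ L.fiber ξ α, L.idem α C ≤ p ∧ C ≤ A := by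
  obtain ⟨z, hz, hzp, hzA⟩ := hξ.isProperFilter.directed hp hA
  rcases eq_bot_or_eq_idem z with rfl | ⟨ζ, C, hC, rfl⟩
  · exact absurd hz hξ.isProperFilter.bot_notMem
  obtain ⟨γ, rfl, hCA⟩ := (idem_le_idem_iff hC).1 hzA
  -- The word `α ++ γ` occurs in `ξ`, so it is no longer than `α`.
  obtain rfl : γ = [] := by
    have := hξ.2.2.2 _ (isLabelledPath_of_nonempty hC) ⟨C, hz⟩
    rw [List.length_append] at this
    exact List.length_eq_zero_iff.1 (by omega)
  -- `C` has type `L.FamAt (α ++ [])`; it is generalised so that the index can be rewritten.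
  clear hCA
  revert C
  rw [List.append_nil]
  intro C hC hz hzp hzA
  exact ⟨C, hz, hzp, (idem_le_idem_self_iff hC).1 hzA⟩

theorem isProperFilter_fiber [Nonempty E] [L.ClosedUnderRelCompl]
    (hξ : L.IsFiniteTypeFilter ξ α) : IsProperFilter (L.fiber ξ α) where
  nonempty := hξ.2.2.1
  bot_notMem h := (hξ.nonempty_of_idem_mem h).ne_empty rfl
  mem_of_le _ _ hA hAB := hξ.isProperFilter.mem_of_le hA
    ((idem_le_idem_self_iff (hξ.nonempty_of_idem_mem hA)).2 hAB)
  directed A B hA hB := by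
    obtain ⟨C, hC, hCA, hCB⟩ := hξ.exists_fiber_le hA hB
    exact ⟨C, hC, (idem_le_idem_self_iff (hξ.nonempty_of_idem_mem hC)).1 hCA, hCB⟩

/-- The fibre at the word of a tight filter of finite type is an ultrafilter. -/
theorem fiber_mem_ultraAt [Nonempty E] [L.ClosedUnderRelCompl]
    (hξ : L.IsFiniteTypeFilter ξ α) (ht : IsTightFilter ξ) : L.fiber ξ α ∈ L.ultraAt α := by
  refine ⟨hξ.isProperFilter_fiber, fun G hG hle C hC => ?_⟩
  obtain ⟨A, hA⟩ := hξ.2.2.1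
  -- Below (α, A, α), a middle entry lies in r(A, γ) = r(A ∩ C, γ) ∪ r(A \ C, γ), so it meets one of
  -- the two pieces.
  have hcover : IsCoverFor {L.idem α (A.inter C.2.1), L.idem α (A.sdiff C.2.1)}
      (L.idem α A) := by
    have hbelow (B : L.FamAt α) (hB : B ≤ A) : L.idem α B ≤ L.idem α A := by
      by_cases h : L.idem α B = ⊥
      · rw [h]; exact bot_le
      · exact (idem_le_idem_self_iff (idem_ne_bot_iff.1 h)).2 hB
    constructor
    · rintro z (rfl | rfl)
      · exact hbelow _ Set.inter_subset_left
      · exact hbelow _ Set.sdiff_subset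
    · intro y hy hy0
      rcases eq_bot_or_eq_idem y with rfl | ⟨ζ, B, hB, rfl⟩
      · exact absurd rfl hy0
      obtain ⟨γ, rfl, hBA⟩ := (idem_le_idem_iff hB).1 hy
      have hp := isLabelledPath_of_nonempty hB
      have meet (D : L.FamAt α) (hD : (B.1 ∩ L.relRange D.1 γ).Nonempty) :
          L.idem α D ⊓ L.idem (α ++ γ) B ≠ ⊥ := by
        have hD' : (B.inter (D.relRange hp).2.1).1.Nonempty := hD
        exact inf_ne_bot_of_le (idem_ne_bot_iff.2 hD')
          ((idem_append_le_iff hD').2 Set.inter_subset_right)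
          ((idem_le_idem_self_iff hD').2 Set.inter_subset_left)
      obtain ⟨y, hy⟩ := hB
      have := hBA hy
      rw [← Set.inter_union_sdiff A.1 C.1, LabelledGraph.relRange_union] at this
      rcases this with h | h
      · exact ⟨_, Or.inl rfl, meet (A.inter C.2.1) ⟨y, hy, h⟩⟩
      · exact ⟨_, Or.inr rfl, meet (A.sdiff C.2.1) ⟨y, hy, h⟩⟩
  obtain ⟨z, rfl | rfl, hz⟩ := hξ.isProperFilter.isTightFilter_iff.1 ht _ hA _
    (Set.toFinite _) hcover
  · exact hξ.isProperFilter_fiber.mem_of_le hz (FamAt.le_iff.2 Set.inter_subset_right)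
  -- Otherwise `G` would contain both A \ C and C, which are disjoint.
  · have hz' : A.sdiff C.2.1 ∈ G := hle hz
    obtain ⟨y, hy, hyC⟩ := inter_nonempty_of_mem hG hz' hC
    exact absurd hyC hy.2

/-- In a tight filter of finite type, a member of the fibre that emits only finitely many letters
contains a nonempty set of sinks. -/
theorem exists_sink_of_finite [Nonempty E] [L.ClosedUnderRelCompl]
    (hξ : L.IsFiniteTypeFilter ξ α) (ht : IsTightFilter ξ) {D : L.FamAt α}
    (hD : D ∈ L.fiber ξ α) (hfin : {b : 𝓐 | (L.relRange D.1 [b]).Nonempty}.Finite) :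
    ∃ B : L.FamAt α, B ≤ D ∧ B.1.Nonempty ∧ ∀ b, L.relRange B.1 [b] = ∅ := by
  have hpath {b : 𝓐} (hb : (L.relRange D.1 [b]).Nonempty) : L.IsLabelledPath (α ++ [b]) := by
    refine L.isLabelledPath_of_range_nonempty (hb.mono ?_)
    rw [LabelledGraph.range_append]
    exact L.relRange_mono D.2.2 _
  let Z : Set L.Idem := {z | ∃ (b : 𝓐) (hb : (L.relRange D.1 [b]).Nonempty),
    z = L.idem (α ++ [b]) (D.relRange (hpath hb))}
  have hZ : Z.Finite := by
    refine (hfin.dependent_image fun b hb =>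
      L.idem (α ++ [b]) (D.relRange (hpath hb))).subset ?_
    rintro z ⟨b, hb, rfl⟩
    exact ⟨b, hb, rfl⟩
  by_contra! hno
  -- An element below (α, D, α) with word `α` emits a letter by `hno`, and its range under that
  -- letter lies below both; one with a longer word already lies below a member of `Z`.
  have hcover : IsCoverFor Z (L.idem α D) := by
    constructor
    · rintro z ⟨b, hb, rfl⟩
      exact (idem_append_le_iff (B := D.relRange (hpath hb)) hb).2 subset_rfl
    · intro y hy hy0
      rcases eq_bot_or_eq_idem y with rfl | ⟨ζ, B, hB, rfl⟩
      · exact absurd rfl hy0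
      obtain ⟨γ, rfl, hBD⟩ := (idem_le_idem_iff hB).1 hy
      rcases γ with _ | ⟨b, γ⟩
      -- A copy of `B` moved from `L.FamAt (α ++ [])` to `L.FamAt α`.
      · obtain ⟨B', hB'⟩ : ∃ B' : L.FamAt α, B'.1 = B.1 :=
          ⟨⟨B.1, B.2.1, B.2.2.trans (by rw [List.append_nil])⟩, rfl⟩
        rw [← hB'] at hBD
        rw [LabelledGraph.relRange_nil] at hBD
        have hne' : B'.1.Nonempty := by rwa [hB']
        obtain ⟨b, hb⟩ := hno B' hBD hne'
        have hDb := hb.mono (L.relRange_mono hBD [b])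
        have hb' : (B'.relRange (hpath hDb)).1.Nonempty := hb
        refine ⟨_, ⟨b, hDb, rfl⟩, inf_ne_bot_of_le (idem_ne_bot_iff.2 hb') ?_ ?_⟩
        · exact (idem_le_idem_self_iff hb').2 (L.relRange_mono hBD [b])
        · refine (idem_le_idem_iff hb').2 ⟨[b], by simp, ?_⟩
          rw [← hB']
          exact subset_rfl
      · rw [LabelledGraph.relRange_cons] at hBD
        have hDb : (L.relRange D.1 [b]).Nonempty := by
          obtain ⟨y, hy⟩ := hB
          obtain ⟨x, hx, -⟩ := hBD hy
          exact ⟨x, hx⟩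
        refine ⟨_, ⟨b, hDb, rfl⟩, inf_ne_bot_of_le hy0 ?_ le_rfl⟩
        exact (idem_le_idem_iff hB).2 ⟨γ, by simp, hBD⟩
  obtain ⟨z, ⟨b, hb, rfl⟩, hz⟩ := hξ.isProperFilter.isTightFilter_iff.1 ht _ hD Z hZ hcover
  have := hξ.2.2.2 _ (hpath hb) ⟨_, hz⟩
  simp at this

/-- A filter of finite type whose fibre is an ultrafilter is tight, provided that below each member
`D` of the fibre, and for every finite set of letters, there is a nonzero element whose word is that
of the filter or extends it by a letter outside the finite set, and which is annihilated by all
words starting with one of those letters. -/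
theorem isTightFilter_of_exists_below [Nonempty E] [L.ClosedUnderRelCompl]
    (hξ : L.IsFiniteTypeFilter ξ α) (hU : L.fiber ξ α ∈ L.ultraAt α)
    (H : ∀ D ∈ L.fiber ξ α, ∀ s : Set 𝓐, s.Finite →
      (∃ B : L.FamAt α, B ≤ D ∧ B.1.Nonempty ∧ ∀ b ∈ s, L.relRange B.1 [b] = ∅) ∨
        ∃ t ∉ s, L.IsLabelledPath (α ++ [t]) ∧ (L.relRange D.1 [t]).Nonempty) :
    IsTightFilter ξ := by
  refine hξ.isProperFilter.isTightFilter_iff.2 fun x hx Z hZ hc => ?_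
  by_contra! hno
  obtain ⟨A, hA⟩ := hξ.2.2.1
  obtain ⟨A', hA', hA'x, -⟩ := hξ.exists_fiber_le hx hA
  -- If r(B, γ) were in the fibre, the larger element `z` would be in `ξ`; hence the ultrafilter has
  -- a member disjoint from r(B, γ).
  have hsep : ∀ z ∈ Z, ∃ C ∈ L.fiber ξ α, ∀ β γ, α = β ++ γ → ∀ B : L.FamAt β,
      z = L.idem β B → L.relRange B.1 γ ∩ C.1 = ∅ := by
    intro z hz
    by_cases hex : ∃ β γ, α = β ++ γ ∧ ∃ B : L.FamAt β, z = L.idem β B ∧ B.1.Nonempty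
    · obtain ⟨β, γ, rfl, B, rfl, hB⟩ := hex
      have hnot : B.relRange hξ.2.1 ∉ L.fiber ξ (β ++ γ) := fun hmem =>
        hno _ hz (hξ.isProperFilter.mem_of_le hmem
          ((idem_append_le_iff (hξ.nonempty_of_idem_mem hmem)).2 subset_rfl))
      obtain ⟨C, hC, hdisj⟩ := exists_disjoint_of_notMem hU hnot
      -- The claim concerns every presentation of `z`; as `z` is nonzero, comparing two
      -- presentations in both directions gives equal words and B' ⊆ B.
      refine ⟨C, hC, fun β' γ' hβ B' hBB' => ?_⟩
      obtain ⟨δ, hδ, h₁⟩ := (idem_le_idem_iff hB).1 hBB'.le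
      have hB' : B'.1.Nonempty := by
        rw [← idem_ne_bot_iff, ← hBB']
        exact idem_ne_bot_iff.2 hB
      obtain ⟨δ', hδ', h₂⟩ := (idem_le_idem_iff hB').1 hBB'.ge
      obtain rfl : δ = [] := by
        rw [hδ'] at hδ
        exact (by simpa using hδ : δ' = [] ∧ δ = []).2
      obtain rfl : β = β' := by simpa using hδ
      obtain rfl : γ = γ' := List.append_cancel_left hβ
      obtain rfl : δ' = [] := by simpa using hδ'
      rw [LabelledGraph.relRange_nil] at h₂
      exact Set.subset_empty_iff.1
        (hdisj ▸ Set.inter_subset_inter_left _ (L.relRange_mono h₂ γ))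
    · refine ⟨A', hA', fun β γ hβ B hzB => ?_⟩
      have : B.1 = ∅ := by
        by_contra hB
        exact hex ⟨β, γ, hβ, B, hzB, Set.nonempty_iff_ne_empty.2 hB⟩
      rw [this, LabelledGraph.relRange_empty, Set.empty_inter]
  obtain ⟨D, hD, hDA', hDZ⟩ := exists_mem_le_of_finite hξ.isProperFilter_fiber hZ hsep
    (fun z C C' hC' h β γ hβ B hz => Set.subset_empty_iff.1
      (h β γ hβ B hz ▸ Set.inter_subset_inter_right _ hC')) hA'
  have hDx : L.idem α D ≤ x := hA'x.trans'
    ((idem_le_idem_self_iff (hξ.nonempty_of_idem_mem hD)).2 hDA')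
  -- The letters that follow `α` in words of `Z` properly extending it. Each `z` contributes at most
  -- one, so `s` is finite.
  let s : Set 𝓐 := {b | ∃ z ∈ Z, ∃ (γ : List 𝓐) (B : L.FamAt (α ++ b :: γ)),
    B.1.Nonempty ∧ z = L.idem (α ++ b :: γ) B}
  have hs : s.Finite := by
    have hsub : s ⊆ ⋃ z ∈ Z, {b | ∃ (γ : List 𝓐) (B : L.FamAt (α ++ b :: γ)),
        B.1.Nonempty ∧ z = L.idem (α ++ b :: γ) B} := by
      rintro b ⟨z, hz, h⟩
      exact Set.mem_biUnion hz h
    refine (hZ.biUnion fun z _ => Set.Subsingleton.finite ?_).subset hsub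
    rintro b ⟨γ, B, hB, rfl⟩ b' ⟨γ', B', hB', h⟩
    obtain ⟨δ, hδ, -⟩ := (idem_le_idem_iff hB).1 h.le
    rw [List.append_assoc, List.cons_append] at hδ
    exact (List.cons.inj (List.append_cancel_left hδ)).1
  rcases H D hD s hs with ⟨B, hBD, hB, hBs⟩ | ⟨t, hts, htp, htD⟩
  -- No `z` can meet (α, B, α): if its word is a prefix of `α`, it is disjoint from `D`; otherwise
  -- the next letter is in `s` and kills `B`.
  · obtain ⟨z, hz, hzB⟩ := hc.2 (L.idem α B)
      (((idem_le_idem_self_iff hB).2 hBD).trans hDx) (idem_ne_bot_iff.2 hB)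
    rcases eq_bot_or_eq_idem z with rfl | ⟨ζ, C, hC, rfl⟩
    · exact hzB (bot_inf_eq _)
    have hpre (γ : List 𝓐) (hγ : α = ζ ++ γ) (hne : (L.relRange C.1 γ ∩ B.1).Nonempty) :
        False := by
      refine (hne.mono (Set.inter_subset_inter_right _ hBD)).ne_empty ?_
      exact hDZ _ hz ζ γ hγ C rfl
    rcases exists_of_idem_inf_ne_bot hzB with ⟨γ, hγ, hne⟩ | ⟨γ, rfl, hne⟩
    · exact hpre γ hγ hne
    · rcases γ with _ | ⟨b, γ⟩
      · refine hpre [] (by simp) ?_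
        simpa using hne
      · have hb : b ∈ s := ⟨_, hz, γ, C, hC, rfl⟩
        rw [LabelledGraph.relRange_cons, hBs b hb, LabelledGraph.relRange_empty,
          Set.inter_empty] at hne
        exact hne.ne_empty rfl
  · have htD' : (D.relRange htp).1.Nonempty := htD
    obtain ⟨z, hz, hzB⟩ := hc.2 (L.idem (α ++ [t]) (D.relRange htp))
      (((idem_append_le_iff htD').2 subset_rfl).trans hDx) (idem_ne_bot_iff.2 htD')
    rcases eq_bot_or_eq_idem z with rfl | ⟨ζ, C, hC, rfl⟩
    · exact hzB (bot_inf_eq _)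
    have hlong (γ : List 𝓐) (hγ : ζ = α ++ t :: γ) : False := by
      subst hγ
      exact hts ⟨_, hz, γ, C, hC, rfl⟩
    rcases exists_of_idem_inf_ne_bot hzB with ⟨γ, hγ, hne⟩ | ⟨γ, hγ, -⟩
    -- The word of `z` is a prefix of αt. If it is αt itself, then t ∈ s. Otherwise it is a prefix
    -- of `α`, and weak left resolving reduces the meet to the range under `t` of a set that `hDZ`
    -- makes empty.
    · rcases List.eq_nil_or_concat' γ with rfl | ⟨γ, b, rfl⟩
      · exact hlong [] (by simpa using hγ.symm)
      · rw [← List.append_assoc] at hγ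
        obtain ⟨hα, hb⟩ := List.append_inj' hγ rfl
        obtain rfl : t = b := by simpa using hb
        have hCγ := LabelledGraph.IsLabelledPath.suffix _ (hα ▸ hξ.2.1)
        rw [LabelledGraph.relRange_append] at hne
        change (_ ∩ L.relRange D.1 [t]).Nonempty at hne
        rw [← relRange_inter (L.relRange_mem _ C.2.1 _ hCγ) D.2.1
          (LabelledGraph.IsLabelledPath.suffix _ htp), hDZ _ hz ζ γ hα C rfl,
          LabelledGraph.relRange_empty] at hne
        exact hne.ne_empty rfl
    · exact hlong γ (by simpa using hγ)

end IsFiniteTypeFilter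

end LabelledSpace

/-! ### The characterisation of tightness -/

open LabelledSpace

theorem mainTheorem6 {V : Type u} {E : Type v} {𝓐 : Type w} [Nonempty E]
    (L : LabelledSpace V E 𝓐) [L.WeaklyLeftResolving] [L.ClosedUnderRelCompl]
    (ξ : Set L.Idem) (α : List 𝓐) (hξ : L.IsFiniteTypeFilter ξ α) :
    IsTightFilter ξ ↔
      L.fiber ξ α ∈ L.ultraAt α ∧
        ((∃ (Λ : Type (max u w)) (_ : Preorder Λ) (_ : IsDirectedOrder Λ) (_ : Nonempty Λ)
            (F : Λ → Set (L.FamAt α)),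
            (∀ l, F l ∈ L.ultraSink α) ∧ NetConvergesTo F (L.fiber ξ α)) ∨
          (∃ (Λ : Type (max u w)) (_ : Preorder Λ) (_ : IsDirectedOrder Λ) (_ : Nonempty Λ)
            (t : Λ → 𝓐) (F : (l : Λ) → Set (L.FamAt (α ++ [t l]))),
            (∀ l, L.IsLabelledPath (α ++ [t l]) ∧ F l ∈ L.ultraAt (α ++ [t l])) ∧
            NetConvergesTo (fun l => L.pullback α [t l] (F l)) (L.fiber ξ α) ∧
            ∀ b : 𝓐, ∃ l₀ : Λ, ∀ l, l₀ ≤ l → t l ≠ b)) := by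
  constructor
  · intro ht
    have hU := hξ.fiber_mem_ultraAt ht
    have hp := hξ.isProperFilter_fiber
    refine ⟨hU, ?_⟩
    obtain ⟨A₀, hA₀⟩ := hp.nonempty
    -- Members of the fibre shrink along the net, giving convergence; the finite sets of letters to
    -- be avoided grow, giving the escape condition in (b).
    let Λ : Type (max u w) := (L.fiber ξ α)ᵒᵈ × Finset 𝓐
    have hdir : IsDirectedOrder Λ := by
      classical
      refine ⟨fun ⟨a, s⟩ ⟨b, s'⟩ => ?_⟩
      obtain ⟨C, hC, hCa, hCb⟩ := hp.directed (OrderDual.ofDual a).2 (OrderDual.ofDual b).2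
      exact ⟨(OrderDual.toDual ⟨C, hC⟩, s ∪ s'), ⟨hCa, Finset.subset_union_left⟩,
        ⟨hCb, Finset.subset_union_right⟩⟩
    have hne : Nonempty Λ := ⟨(OrderDual.toDual ⟨A₀, hA₀⟩, ∅)⟩
    by_cases hsink : ∀ D ∈ L.fiber ξ α,
        ∃ B : L.FamAt α, B ≤ D ∧ B.1.Nonempty ∧ ∀ b, L.relRange B.1 [b] = ∅
    · left
      have hex (l : Λ) : ∃ F : Set (L.FamAt α), F ∈ L.ultraSink α ∧
          (OrderDual.ofDual l.1).1 ∈ F := by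
        obtain ⟨B, hBD, hB, hBs⟩ := hsink _ (OrderDual.ofDual l.1).2
        obtain ⟨F, hF, hBF⟩ := exists_isUltrafilterIn_mem (FamAt.ne_bot_iff.2 hB)
        exact ⟨F, ⟨hF, fun b => ⟨B, hBF, hBs b⟩⟩, hF.1.mem_of_le hBF hBD⟩
      choose F hF hDF using hex
      refine ⟨Λ, inferInstance, hdir, hne, F, hF, netConvergesTo_of_eventually_mem hU
        (fun l A hA B hB => inter_nonempty_of_mem (hF l).1.1 hA hB) fun D hD => ?_⟩
      exact ⟨(OrderDual.toDual ⟨D, hD⟩, ∅), fun l hl => (hF l).1.1.mem_of_le (hDF l) hl.1⟩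
    · right
      push Not at hsink
      obtain ⟨D₀, hD₀, hns⟩ := hsink
      have hex (l : Λ) : ∃ (t : 𝓐) (F : Set (L.FamAt (α ++ [t]))), t ∉ l.2 ∧
          L.IsLabelledPath (α ++ [t]) ∧ F ∈ L.ultraAt (α ++ [t]) ∧
          (OrderDual.ofDual l.1).1 ∈ L.pullback α [t] F := by
        obtain ⟨⟨D, hD⟩, s⟩ := l
        obtain ⟨D', hD', hD'D, hD'D₀⟩ := hp.directed hD hD₀
        -- `D'` lies below `D₀`, so it contains no nonempty sink set; by tightness it must emit
        -- infinitely many letters.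
        have hinf : {b : 𝓐 | (L.relRange D'.1 [b]).Nonempty}.Infinite := by
          intro hfin
          obtain ⟨B, hB, hBne, hBs⟩ := hξ.exists_sink_of_finite ht hD' hfin
          obtain ⟨b, hb⟩ := hns B (hB.trans hD'D₀) hBne
          exact hb.ne_empty (hBs b)
        obtain ⟨t, ht, hts⟩ := hinf.exists_notMem_finset s
        have htD : (L.relRange D.1 [t]).Nonempty := ht.mono (L.relRange_mono hD'D [t])
        have hpath : L.IsLabelledPath (α ++ [t]) := by
          refine L.isLabelledPath_of_range_nonempty (htD.mono ?_)
          rw [LabelledGraph.range_append]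
          exact L.relRange_mono D.2.2 _
        obtain ⟨F, hF, hDF⟩ := exists_isUltrafilterIn_mem
          (FamAt.ne_bot_iff.2 (show (D.relRange hpath).1.Nonempty from htD))
        exact ⟨t, F, hts, hpath, hF, _, hDF, rfl⟩
      choose t F hts hpath hF hDF using hex
      refine ⟨Λ, inferInstance, hdir, hne, t, F, fun l => ⟨hpath l, hF l⟩,
        netConvergesTo_of_eventually_mem hU ?_ fun D hD => ?_, fun b => ?_⟩
      -- Members of a pullback meet because r(A, t) ∩ r(B, t) = r(A ∩ B, t).
      · rintro l A ⟨C, hC, hCA⟩ B ⟨C', hC', hCB⟩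
        have := inter_nonempty_of_mem (hF l).1 hC hC'
        rw [hCA, hCB, ← relRange_inter A.2.1 B.2.1
          (LabelledGraph.IsLabelledPath.suffix _ (hpath l))] at this
        obtain ⟨y, x, hx, -⟩ := this
        exact ⟨x, hx⟩
      · refine ⟨(OrderDual.toDual ⟨D, hD⟩, ∅), fun l hl => ?_⟩
        obtain ⟨C, hC, hCD⟩ := hDF l
        refine ⟨D.relRange (hpath l), (hF l).1.mem_of_le hC ?_, rfl⟩
        rw [FamAt.le_iff, hCD]
        exact L.relRange_mono hl.1 _
      · refine ⟨(OrderDual.toDual ⟨A₀, hA₀⟩, {b}), fun l hl hb => hts l ?_⟩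
        exact hl.2 (by simp [hb])
  · rintro ⟨hU, ⟨Λ, _, _, _, F, hF, hconv⟩ | ⟨Λ, _, _, _, t, F, hF, hconv, hesc⟩⟩
    · refine hξ.isTightFilter_of_exists_below hU fun D hD s hs => Or.inl ?_
      obtain ⟨l, hl⟩ := hconv D
      have hDl := (hl l le_rfl).2 hD
      -- Each letter is killed by its own member of `F l`; as `s` is finite, one member below `D`
      -- kills them all.
      obtain ⟨B, hB, hBD, hBs⟩ := exists_mem_le_of_finite (hF l).1.1 hs
        (p := fun b C => L.relRange C.1 [b] = ∅) (fun b _ => (hF l).2 b)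
        (fun b C C' hC' h => Set.subset_empty_iff.1 (h ▸ L.relRange_mono hC' [b])) hDl
      exact ⟨B, hBD, nonempty_of_mem (hF l).1.1 hB, hBs⟩
    · refine hξ.isTightFilter_of_exists_below hU fun D hD s hs => Or.inr ?_
      obtain ⟨l₀, hl₀⟩ := hconv D
      choose m hm using hesc
      -- A common bound for the finitely many thresholds of letters in `s`; beyond it `t l` lies
      -- outside `s`.
      obtain ⟨l₁, hl₁⟩ := (hs.image m).exists_le
      obtain ⟨l, hll₀, hll₁⟩ := exists_ge_ge l₀ l₁
      obtain ⟨C, hC, hCD⟩ := (hl₀ l hll₀).2 hD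
      refine ⟨t l, fun hts => ?_, (hF l).1, hCD ▸ nonempty_of_mem (hF l).2.1 hC⟩
      exact hm _ l ((hl₁ _ (Set.mem_image_of_mem m hts)).trans hll₁) rfl
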